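/- All matroids are finite and have at least two elements. For matroids $N$ and $M$, an $N$-minor of $M$ is a minor of $M$ isomorphic to $N$; it uses $\{e,f\}$ if $e$ and $f$ both belong to its ground set. A matroid $M$ is $N$-connected if $|E(M)|\ge 2$ and, for every pair of distinct elements $e,f$ of $E(M)$, there is an $N$-minor of $M$ using $\{e,f\}$. A matroid $N$ has the transitivity property if, for every matroid $M$ and every triple $\{e,f,g\}\subseteq E(M)$ of distinct elements, whenever $M$ has an $N$-minor using $\{e,f\}$ and an $N$-minor using $\{f,g\}$, it also has an $N$-minor using $\{e,g\}$. Let $N$ be a matroid with the transitivity property such that, whenever $M$ is an $N$-connected matroid with $|E(M)|>|E(N)|$ and $e\in E(M)$, at least one of $M\backslash e$ and $M/e$ is $N$-connected. Then $N\cong U_{1,2}$. -/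

import Mathlib

namespace NConn

universe u v

/-- Two matroids are isomorphic if there is a bijection between their ground sets that maps
independent sets to independent sets in both directions. -/
def Iso {α : Type u} {β : Type v} (M : Matroid α) (N : Matroid β) : Prop :=
  ∃ φ : M.E ≃ N.E, ∀ I : Set M.E,
    M.Indep (Subtype.val '' I) ↔ N.Indep (Subtype.val '' (φ '' I))

/-- The uniform matroid `U_{r,n}` on `n` elements, whose independent sets are the sets with at
most `r` elements. -/
def uniform (r n : ℕ) : Matroid (Fin n) :=
  (IndepMatroid.ofFinite (E := Set.univ) Set.finite_univ
    (Indep := fun I => I.ncard ≤ r)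
    (indep_empty := by simp)
    (indep_subset := fun _ J hJ hIJ =>
      (Set.ncard_le_ncard hIJ (Set.toFinite J)).trans hJ)
    (indep_aug := by
      intro I J _ hJ hlt
      obtain ⟨e, heJ, heI⟩ := Set.exists_mem_notMem_of_ncard_lt_ncard hlt (Set.toFinite I)
      refine ⟨e, heJ, heI, ?_⟩
      rw [Set.ncard_insert_of_notMem heI (Set.toFinite I)]
      omega)
    (subset_ground := fun _ _ => Set.subset_univ _)).matroid

/-- `M` has an `N`-minor using `{e, f}`: some minor of `M` is isomorphic to `N` and has both
`e` and `f` in its ground set. -/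
def HasMinorUsing {α : Type u} {β : Type v} (N : Matroid α) (M : Matroid β) (e f : β) : Prop :=
  ∃ N' : Matroid β, N'.IsMinor M ∧ Iso N' N ∧ e ∈ N'.E ∧ f ∈ N'.E

/-- `M` is `N`-connected: `M` has at least two elements, and every two distinct elements of `M`
are together in an `N`-minor of `M`. -/
def IsConn {α : Type u} {β : Type v} (N : Matroid α) (M : Matroid β) : Prop :=
  2 ≤ M.E.encard ∧ ∀ e ∈ M.E, ∀ f ∈ M.E, e ≠ f → HasMinorUsing N M e f

/-- The transitivity property of a matroid `N`. All matroids are finite, so letting `M` range over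
the universe of `N` covers every matroid up to isomorphism. -/
def Transitivity {α : Type u} (N : Matroid α) : Prop :=
  ∀ (β : Type u) (M : Matroid β), M.Finite →
    ∀ e ∈ M.E, ∀ f ∈ M.E, ∀ g ∈ M.E, e ≠ f → f ≠ g → e ≠ g →
      HasMinorUsing N M e f → HasMinorUsing N M f g → HasMinorUsing N M e g

/-- Every `N`-connected matroid `M` with more elements than `N` remains `N`-connected after the
deletion or the contraction of any given element. -/
def DeleteOrContract {α : Type u} (N : Matroid α) : Prop :=
  ∀ (β : Type u) (M : Matroid β), M.Finite → IsConn N M → N.E.encard < M.E.encard →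
    ∀ e ∈ M.E, IsConn N (M.delete {e}) ∨ IsConn N (M.contract {e})

end NConn

namespace NConn

open Set

universe u v

variable {α : Type u} {β : Type v}

/-! Add to `N` a clone of an element `e`, in parallel with it. By transitivity this extension is
`N`-connected (`parallelExt_isConn`). It has one element more than `N`, and contracting a nonloop
lowers its rank, so every single-element deletion of it is a copy of `N`. Comparing numbers of
dependent pairs over these deletions makes any two elements of `N` tied, and comparing numbers of
loops excludes a mixture of loops and nonloops. Thus `N` consists of loops only or is one parallel
class.

Transitivity alone settles both cases. A matroid `M` is built in which contracting either of two
elements gives `N`, yet no `N`-minor uses both. This excludes rank zero and parallel classes of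
three or more elements. -/

lemma subsingleton_image_iff_of_injOn {f : β → α} {s : Set β} (hf : InjOn f s) :
    (f '' s).Subsingleton ↔ s.Subsingleton :=
  ⟨fun h a ha b hb => hf ha hb (h ⟨a, ha, rfl⟩ ⟨b, hb, rfl⟩), fun h => h.image _⟩

/-- `M` and `N` are isomorphic iff some map restricts to a bijection of the ground sets that
preserves independence. -/
lemma iso_iff_exists_bijOn [Nonempty α] {M : Matroid β} {N : Matroid α} :
    Iso M N ↔ ∃ f : β → α, BijOn f M.E N.E ∧ ∀ I ⊆ M.E, (M.Indep I ↔ N.Indep (f '' I)) := by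
  classical
  constructor
  · rintro ⟨φ, hφ⟩
    let f : β → α := fun b => if h : b ∈ M.E then (φ ⟨b, h⟩ : α) else Classical.arbitrary α
    have hf : ∀ x : M.E, f x = φ x := fun x => by simp [f]
    refine ⟨f, ⟨?_, ?_, ?_⟩, ?_⟩
    · intro x hx
      rw [hf ⟨x, hx⟩]
      exact (φ ⟨x, hx⟩).2
    · intro x hx y hy hxy
      rw [hf ⟨x, hx⟩, hf ⟨y, hy⟩] at hxy
      simpa using φ.injective (Subtype.ext hxy)
    · intro y hy
      refine ⟨φ.symm ⟨y, hy⟩, (φ.symm ⟨y, hy⟩).2, ?_⟩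
      rw [hf, Equiv.apply_symm_apply]
    · intro I hI
      have h := hφ (Subtype.val ⁻¹' I)
      rw [Subtype.image_preimage_coe, inter_eq_self_of_subset_right hI] at h
      rw [h]
      have h1 : f '' I = Subtype.val '' (φ '' (Subtype.val ⁻¹' I)) := by
        ext y
        constructor
        · rintro ⟨x, hx, rfl⟩
          exact ⟨φ ⟨x, hI hx⟩, ⟨⟨x, hI hx⟩, hx, rfl⟩, (hf ⟨x, hI hx⟩).symm⟩
        · rintro ⟨_, ⟨x, hx, rfl⟩, rfl⟩
          exact ⟨x, hx, hf x⟩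
      rw [h1]
  · rintro ⟨f, hf, hI⟩
    refine ⟨hf.equiv f, fun I => ?_⟩
    rw [hI _ (by simp)]
    have h1 : f '' (Subtype.val '' I) = Subtype.val '' (hf.equiv f '' I) := by
      rw [image_image, image_image]
      rfl
    rw [h1]

lemma Iso.encard_eq {M : Matroid β} {N : Matroid α} (h : Iso M N) :
    M.E.encard = N.E.encard := by
  obtain ⟨φ, -⟩ := h
  exact ENat.card_congr φ

/-- An `N`-minor with as many elements as `M` is `M` itself. -/
lemma IsConn.iso_of_encard_eq {N : Matroid α} {M : Matroid β} [N.Finite] (h : IsConn N M)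
    (hE : M.E.encard = N.E.encard) : Iso M N := by
  obtain ⟨h2, hM⟩ := h
  have hM_fin : M.E.Finite := by
    rw [← encard_lt_top_iff, hE]
    exact N.ground_finite.encard_lt_top
  obtain ⟨a, b, ha, hb, hab⟩ := one_lt_encard_iff.1
    (lt_of_lt_of_le (by norm_num) h2 : 1 < M.E.encard)
  obtain ⟨N', hmin, hiso, -, -⟩ := hM a ha b hb hab
  have hcard : N'.E.encard = M.E.encard := hE ▸ hiso.encard_eq
  have heq : N'.E = M.E := hM_fin.eq_of_subset_of_encard_le' hmin.subset hcard.ge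
  rwa [hmin.eq_of_ground_subset heq.ge]

/-! ### Counting tied pairs -/

/-- Equality, or dependence of the pair. -/
def Tied (M : Matroid β) (a b : β) : Prop := a = b ∨ ¬ M.Indep {a, b}

lemma Tied.symm {M : Matroid β} {a b : β} (h : Tied M a b) : Tied M b a := by
  unfold Tied at *
  rwa [pair_comm, eq_comm]

lemma tied_comm {M : Matroid β} {a b : β} : Tied M a b ↔ Tied M b a := ⟨.symm, .symm⟩

/-- The tied pairs of elements of the ground set. -/
def tiedPairs (M : Matroid β) : Set (β × β) := {p | p.1 ∈ M.E ∧ p.2 ∈ M.E ∧ Tied M p.1 p.2}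

/-- The elements of the ground set tied to `x`. -/
def tiedTo (M : Matroid β) (x : β) : Set β := {b ∈ M.E | Tied M x b}

lemma Iso.ncard_tiedPairs [Nonempty α] {M : Matroid β} {N : Matroid α} (h : Iso M N) :
    (tiedPairs M).ncard = (tiedPairs N).ncard := by
  obtain ⟨f, hf, hI⟩ := iso_iff_exists_bijOn.1 h
  have key : ∀ a ∈ M.E, ∀ b ∈ M.E, (Tied N (f a) (f b) ↔ Tied M a b) := by
    intro a ha b hb
    unfold Tied
    rw [hf.injOn.eq_iff ha hb, hI _ (pair_subset ha hb), image_pair]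
  have himg : tiedPairs N = Prod.map f f '' tiedPairs M := by
    ext ⟨a, b⟩
    constructor
    · rintro ⟨ha, hb, hab⟩
      obtain ⟨c, hc, rfl⟩ := hf.surjOn ha
      obtain ⟨d, hd, rfl⟩ := hf.surjOn hb
      exact ⟨(c, d), ⟨hc, hd, (key c hc d hd).1 hab⟩, rfl⟩
    · rintro ⟨⟨c, d⟩, ⟨hc, hd, hcd⟩, h⟩
      obtain ⟨rfl, rfl⟩ := Prod.mk.inj h
      exact ⟨hf.mapsTo hc, hf.mapsTo hd, (key c hc d hd).2 hcd⟩
  rw [himg, InjOn.ncard_image]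
  rintro ⟨a, b⟩ ⟨ha, hb, -⟩ ⟨c, d⟩ ⟨hc, hd, -⟩ h
  obtain ⟨h1, h2⟩ := Prod.mk.inj h
  exact Prod.ext (hf.injOn ha hc h1) (hf.injOn hb hd h2)

lemma Iso.ncard_loops [Nonempty α] {M : Matroid β} {N : Matroid α} (h : Iso M N) :
    {x ∈ M.E | ¬ M.Indep {x}}.ncard = {x ∈ N.E | ¬ N.Indep {x}}.ncard := by
  obtain ⟨f, hf, hI⟩ := iso_iff_exists_bijOn.1 h
  have key : ∀ a ∈ M.E, (M.Indep {a} ↔ N.Indep {f a}) := fun a ha => by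
    rw [hI _ (singleton_subset_iff.2 ha), image_singleton]
  have himg : {x ∈ N.E | ¬ N.Indep {x}} = f '' {x ∈ M.E | ¬ M.Indep {x}} := by
    ext y
    constructor
    · rintro ⟨hy, hy'⟩
      obtain ⟨x, hx, rfl⟩ := hf.surjOn hy
      exact ⟨x, ⟨hx, fun h => hy' ((key x hx).1 h)⟩, rfl⟩
    · rintro ⟨x, ⟨hx, hx'⟩, rfl⟩
      exact ⟨hf.mapsTo hx, fun h => hx' ((key x hx).2 h)⟩
  rw [himg, (hf.injOn.mono (sep_subset _ _)).ncard_image]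

/-- The pairs lost have `x` in the first or the second coordinate; `(x, x)` is counted in both,
whence the `+ 1`. -/
lemma ncard_tiedPairs_delete {M : Matroid β} [M.Finite] {x : β} (hx : x ∈ M.E) :
    (tiedPairs M).ncard + 1 = (tiedPairs (M.delete {x})).ncard + 2 * (tiedTo M x).ncard := by
  have hA : (tiedTo M x).Finite := M.ground_finite.subset (sep_subset _ _)
  have hxA : x ∈ tiedTo M x := ⟨hx, Or.inl rfl⟩
  have hD : (tiedPairs (M.delete {x})).Finite :=
    (M.ground_finite.prod M.ground_finite).subset fun p hp => ⟨hp.1.1, hp.2.1.1⟩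
  have hsplit : tiedPairs M = tiedPairs (M.delete {x}) ∪
      (Prod.mk x '' tiedTo M x ∪ (fun a => (a, x)) '' (tiedTo M x \ {x})) := by
    ext ⟨a, b⟩
    by_cases ha : a = x
    · subst ha
      simp [tiedPairs, tiedTo, hx]
    by_cases hb : b = x
    · subst hb
      simp [tiedPairs, tiedTo, hx, ha, Ne.symm ha, tied_comm (a := a)]
    · simp [tiedPairs, tiedTo, Tied, ha, hb, Ne.symm ha, Ne.symm hb, Matroid.delete_indep_iff]
  have hd1 : Disjoint (Prod.mk x '' tiedTo M x) ((fun a => (a, x)) '' (tiedTo M x \ {x})) := by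
    rw [disjoint_left]
    rintro _ ⟨b, -, rfl⟩ ⟨a, ha, h⟩
    exact ha.2 (Prod.mk.inj h).1
  have hd2 : Disjoint (tiedPairs (M.delete {x}))
      (Prod.mk x '' tiedTo M x ∪ (fun a => (a, x)) '' (tiedTo M x \ {x})) := by
    rw [disjoint_left]
    rintro _ ⟨h1, h2, -⟩ (⟨b, -, rfl⟩ | ⟨a, -, rfl⟩)
    · exact h1.2 rfl
    · exact h2.2 rfl
  rw [hsplit, ncard_union_eq hd2 hD ((hA.image _).union (hA.sdiff.image _)),
    ncard_union_eq hd1 (hA.image _) (hA.sdiff.image _),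
    ncard_image_of_injective _ (Prod.mk_right_injective x),
    ncard_image_of_injective _ (Prod.mk_left_injective x)]
  have := ncard_sdiff_singleton_add_one hxA hA
  omega

/-! ### Parallel extensions -/

/-- The extension of `N` by an element `none` parallel to `e` (a loop if `e` is a loop). -/
noncomputable def parallelExt (N : Matroid α) (e : α) : Matroid (Option α) :=
  N.comap (fun o => o.getD e)

section parallelExt

variable {N : Matroid α} {e : α}

lemma bijOn_getD {E : Set α} (he : e ∈ E) {x : Option α} (hx : x = none ∨ x = some e) :
    BijOn (fun o : Option α => o.getD e) (((fun o => o.getD e) ⁻¹' E) \ {x}) E := by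
  refine ⟨fun o ho => ho.1, ?_, ?_⟩
  · rcases hx with rfl | rfl <;> rintro (_ | a) ⟨ha, ha'⟩ (_ | b) ⟨hb, hb'⟩ h <;> simp_all
  · intro y hy
    rcases hx with rfl | rfl
    · exact ⟨some y, ⟨hy, by simp⟩, rfl⟩
    · by_cases h : y = e
      · exact ⟨none, ⟨he, by simp⟩, h.symm⟩
      · exact ⟨some y, ⟨hy, by simpa using h⟩, rfl⟩

lemma encard_preimage_getD {E : Set α} (he : e ∈ E) :
    ((fun o : Option α => o.getD e) ⁻¹' E).encard = E.encard + 1 := by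
  have h : E.encard = _ := (bijOn_getD he (Or.inl rfl)).image_eq ▸
    (bijOn_getD he (Or.inl rfl)).injOn.encard_image
  rw [h, encard_sdiff_singleton_add_one (by exact he)]

lemma parallelExt_encard (he : e ∈ N.E) : (parallelExt N e).E.encard = N.E.encard + 1 :=
  encard_preimage_getD he

lemma parallelExt_finite [N.Finite] (he : e ∈ N.E) : (parallelExt N e).Finite := by
  refine ⟨?_⟩
  rw [← encard_lt_top_iff, parallelExt_encard he]
  exact ENat.add_lt_top.2 ⟨N.ground_finite.encard_lt_top, by simp⟩

lemma parallelExt_delete_iso (he : e ∈ N.E) {x : Option α} (hx : x = none ∨ x = some e) :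
    Iso ((parallelExt N e).delete {x}) N := by
  have : Nonempty α := ⟨e⟩
  have hb := bijOn_getD he hx
  refine iso_iff_exists_bijOn.2 ⟨fun o => o.getD e, hb, fun I hI => ?_⟩
  rw [Matroid.delete_indep_iff, parallelExt, Matroid.comap_indep_iff]
  exact ⟨fun h => h.1.1, fun h => ⟨⟨h, hb.injOn.mono hI⟩, disjoint_left.2 fun y hy => (hI hy).2⟩⟩

lemma hasMinorUsing_parallelExt (he : e ∈ N.E) {x a b : Option α} (hx : x = none ∨ x = some e)
    (ha : a ∈ (parallelExt N e).E) (hax : a ≠ x) (hb : b ∈ (parallelExt N e).E) (hbx : b ≠ x) :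
    HasMinorUsing N (parallelExt N e) a b :=
  ⟨_, ⟨∅, {x}, by rw [Matroid.contract_empty]⟩, parallelExt_delete_iso he hx, ⟨ha, hax⟩,
    ⟨hb, hbx⟩⟩

lemma HasMinorUsing.symm {N : Matroid α} {M : Matroid β} {e f : β} (h : HasMinorUsing N M e f) :
    HasMinorUsing N M f e := by
  obtain ⟨N', h1, h2, h3, h4⟩ := h
  exact ⟨N', h1, h2, h4, h3⟩

/-- Deleting either clone gives `N`, which handles every pair except the two clones. Transitivity
through a third element `y` handles that pair. -/
lemma parallelExt_isConn [N.Finite] (h2 : 2 ≤ N.E.encard) (htrans : Transitivity N)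
    (he : e ∈ N.E) : IsConn N (parallelExt N e) := by
  have he' : some e ∈ (parallelExt N e).E := he
  have hn : none ∈ (parallelExt N e).E := he
  refine ⟨h2.trans ((parallelExt_encard he).symm ▸ le_self_add), fun a ha b hb hab => ?_⟩
  obtain ⟨y, hy, hye⟩ := exists_ne_of_one_lt_encard (lt_of_lt_of_le (by norm_num) h2) e
  have hy' : some y ∈ (parallelExt N e).E := hy
  have hye' : some y ≠ some e := by simpa using hye
  have key : HasMinorUsing N (parallelExt N e) none (some e) :=
    htrans _ _ (parallelExt_finite he) none hn (some y) hy' (some e) he'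
      (by simp) hye' (by simp)
      (hasMinorUsing_parallelExt he (Or.inr rfl) hn (by simp) hy' hye')
      (hasMinorUsing_parallelExt he (Or.inl rfl) hy' (by simp) he' (by simp))
  by_cases h1 : a ≠ none ∧ b ≠ none
  · exact hasMinorUsing_parallelExt he (Or.inl rfl) ha h1.1 hb h1.2
  by_cases h2 : a ≠ some e ∧ b ≠ some e
  · exact hasMinorUsing_parallelExt he (Or.inr rfl) ha h2.1 hb h2.2
  have h3 : (a = none ∧ b = some e) ∨ (a = some e ∧ b = none) := by grind
  rcases h3 with ⟨rfl, rfl⟩ | ⟨rfl, rfl⟩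
  · exact key
  · exact key.symm

/-- A base of `N` pulled back to the contraction and enlarged by `x` would be independent in the
extension, whose rank is only that of `N`. -/
lemma not_iso_parallelExt_contract [N.Finite] {x : Option α}
    (hx : (parallelExt N e).IsNonloop x) : ¬ Iso ((parallelExt N e).contract {x}) N := by
  have : Nonempty α := ⟨e⟩
  intro h
  obtain ⟨f, hf, hI⟩ := iso_iff_exists_bijOn.1 h
  obtain ⟨B, hB⟩ := N.exists_isBase
  obtain ⟨J, hJE, hJ⟩ := subset_image_iff.1 (hf.image_eq.symm ▸ hB.subset_ground)
  have hJ_ind := (hI J hJE).2 (hJ ▸ hB.indep)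
  rw [hx.contractElem_indep_iff, parallelExt, Matroid.comap_indep_iff] at hJ_ind
  obtain ⟨hxJ, hind, hinj⟩ := hJ_ind
  have h1 := hind.encard_le_eRank
  rw [hinj.encard_image, encard_insert_of_notMem hxJ, ← hB.encard_eq_eRank, ← hJ,
    (hf.injOn.mono hJE).encard_image, ENat.add_one_le_iff] at h1
  · exact lt_irrefl _ h1
  · rw [← (hf.injOn.mono hJE).encard_image, hJ]
    exact (N.ground_finite.subset hB.subset_ground).encard_lt_top.ne

lemma parallelExt_delete_iso_of_deleteOrContract [N.Finite] (h2 : 2 ≤ N.E.encard)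
    (htrans : Transitivity N) (hconn : DeleteOrContract N) (he : e ∈ N.E) {x : Option α}
    (hx : x ∈ (parallelExt N e).E) : Iso ((parallelExt N e).delete {x}) N := by
  have hfin := parallelExt_finite he
  have hcard : ((parallelExt N e).E \ {x}).encard = N.E.encard := by
    have h := encard_sdiff_singleton_add_one hx
    rw [parallelExt_encard he] at h
    exact WithTop.add_right_cancel ENat.one_ne_top h
  have hlt : N.E.encard < (parallelExt N e).E.encard := by
    rw [parallelExt_encard he]
    exact ENat.lt_add_one_iff N.ground_finite.encard_lt_top.ne |>.2 le_rfl
  rcases hconn _ _ hfin (parallelExt_isConn h2 htrans he) hlt x hx with h | h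
  · exact h.iso_of_encard_eq (M := (parallelExt N e).delete {x}) hcard
  · have hiso := h.iso_of_encard_eq (M := (parallelExt N e).contract {x}) hcard
    rcases (parallelExt N e).isLoop_or_isNonloop x hx with hl | hnl
    · rwa [Matroid.contract_eq_delete_of_subset_loops (singleton_subset_iff.2 hl)] at hiso
    · exact absurd hiso (not_iso_parallelExt_contract hnl)

lemma parallelExt_tied_iff {a b : Option α} :
    Tied (parallelExt N e) a b ↔ Tied N (a.getD e) (b.getD e) := by
  unfold Tied
  rw [parallelExt, Matroid.comap_indep_iff, image_pair, injOn_pair]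
  grind

lemma ncard_tiedTo_parallelExt_none [N.Finite] (he : e ∈ N.E) :
    (tiedTo (parallelExt N e) none).ncard = (tiedTo N e).ncard + 1 := by
  have h : tiedTo (parallelExt N e) none = insert none (some '' tiedTo N e) := by
    ext (_ | b)
    · simpa [tiedTo, parallelExt_tied_iff, parallelExt, Tied] using he
    · simp only [tiedTo, mem_ofPred_eq, parallelExt_tied_iff]
      simp [parallelExt]
  have hfin : (tiedTo N e).Finite := N.ground_finite.subset (sep_subset _ _)
  rw [h, ncard_insert_of_notMem (by simp)
    (hfin.image _),
    ncard_image_of_injective _ (Option.some_injective _)]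

lemma ncard_tiedTo_parallelExt_some {x : α} (hxe : ¬ Tied N x e) :
    (tiedTo (parallelExt N e) (some x)).ncard = (tiedTo N x).ncard := by
  have h : tiedTo (parallelExt N e) (some x) = some '' tiedTo N x := by
    ext (_ | b) <;> simp only [tiedTo, mem_ofPred_eq, parallelExt_tied_iff]
    · simp [hxe]
    · simp [parallelExt]
  rw [h, ncard_image_of_injective _ (Option.some_injective _)]

/-- Deleting `none` and deleting `some x` leave equally many tied pairs, so both elements are tied
to equally many; the clone adds one to the count for `e` but none to that for `x`. -/
lemma ncard_tiedTo_eq_add_one [N.Finite] (he : e ∈ N.E) {x : α} (hx : x ∈ N.E)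
    (h : ∀ y ∈ (parallelExt N e).E, Iso ((parallelExt N e).delete {y}) N)
    (hxe : ¬ Tied N x e) : (tiedTo N x).ncard = (tiedTo N e).ncard + 1 := by
  have : Nonempty α := ⟨e⟩
  have := parallelExt_finite he
  have hn : none ∈ (parallelExt N e).E := he
  have hs : some x ∈ (parallelExt N e).E := hx
  have h1 := ncard_tiedPairs_delete hn
  have h2 := ncard_tiedPairs_delete hs
  rw [(h _ hn).ncard_tiedPairs, ncard_tiedTo_parallelExt_none he] at h1
  rw [(h _ hs).ncard_tiedPairs, ncard_tiedTo_parallelExt_some hxe] at h2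
  omega

/-- Cloning a loop and then deleting a nonloop leaves one loop too many. -/
lemma not_iso_parallelExt_delete_of_loop [N.Finite] (he : e ∈ N.E) (hl : ¬ N.Indep {e}) {x : α}
    (hx : N.Indep {x}) : ¬ Iso ((parallelExt N e).delete {some x}) N := by
  intro h
  have : Nonempty α := ⟨e⟩
  have hc := h.ncard_loops
  have heq : {y ∈ ((parallelExt N e).delete {some x}).E |
      ¬ ((parallelExt N e).delete {some x}).Indep {y}} =
      insert none (some '' {y ∈ N.E | ¬ N.Indep {y}}) := by
    have hxy : ∀ y, ¬ N.Indep {y} → y ≠ x := fun y hy h => hy (h ▸ hx)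
    ext (_ | y)
    · simp [-Matroid.indep_singleton, parallelExt, Matroid.delete_indep_iff, he, hl]
    · simp only [parallelExt, Matroid.delete_indep_iff, Matroid.comap_indep_iff]
      simp [-Matroid.indep_singleton]
      have := hxy y
      tauto
  rw [heq, ncard_insert_of_notMem (by simp)
    ((N.ground_finite.subset (sep_subset _ _)).image _),
    ncard_image_of_injective _ (Option.some_injective _)] at hc
  omega

end parallelExt

/-! ### Reduction to rank at most one -/

/-- A matroid with both properties has rank at most one, and is loopless unless it has rank
zero. -/
lemma Transitivity.indep_iff_subsingleton {N : Matroid α} [N.Finite] (h2 : 2 ≤ N.E.encard)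
    (htrans : Transitivity N) (hconn : DeleteOrContract N) :
    (∀ I, N.Indep I ↔ I = ∅) ∨ ∀ I, N.Indep I ↔ I ⊆ N.E ∧ I.Subsingleton := by
  have hdel : ∀ e ∈ N.E, ∀ y ∈ (parallelExt N e).E, Iso ((parallelExt N e).delete {y}) N :=
    fun e he y hy => parallelExt_delete_iso_of_deleteOrContract h2 htrans hconn he hy
  have htied : ∀ a ∈ N.E, ∀ b ∈ N.E, Tied N a b := by
    intro a ha b hb
    by_contra hab
    -- Being untied is symmetric, so each count would exceed the other by one.
    have h1 := ncard_tiedTo_eq_add_one hb ha (hdel b hb) hab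
    have h2 := ncard_tiedTo_eq_add_one ha hb (hdel a ha) (fun h => hab h.symm)
    omega
  have hsub : ∀ I, N.Indep I → I ⊆ N.E ∧ I.Subsingleton := by
    refine fun I hI => ⟨hI.subset_ground, fun a ha b hb => ?_⟩
    exact (htied a (hI.subset_ground ha) b (hI.subset_ground hb)).resolve_right
      (not_not.2 (hI.subset (pair_subset ha hb)))
  by_cases hl : ∃ x, N.Indep {x}
  · right
    refine fun I => ⟨hsub I, fun ⟨hIE, hI⟩ => ?_⟩
    obtain rfl | ⟨y, rfl⟩ := hI.eq_empty_or_singleton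
    · exact N.empty_indep
    · obtain ⟨x, hx⟩ := hl
      by_contra hy
      have hyE : y ∈ N.E := singleton_subset_iff.1 hIE
      have hxE : x ∈ N.E := singleton_subset_iff.1 hx.subset_ground
      exact not_iso_parallelExt_delete_of_loop hyE hy hx (hdel y hyE (some x) hxE)
  · left
    refine fun I => ⟨fun hI => ?_, fun h => h ▸ N.empty_indep⟩
    obtain h | ⟨y, rfl⟩ := (hsub I hI).2.eq_empty_or_singleton
    · exact h
    · exact absurd ⟨y, hI⟩ hl

/-! ### Excluding rank zero and large parallel classes -/

/-- If contracting either of `none` and `some e` in `M` gives a copy of `N`, then these two elements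
lie together in an `N`-minor of `M`. -/
lemma Transitivity.hasMinorUsing_none_some {N : Matroid α} (h2 : 2 ≤ N.E.encard)
    (htrans : Transitivity N) {e : α} (he : e ∈ N.E) {M : Matroid (Option α)} (hM : M.Finite)
    (hME : M.E = (fun o : Option α => o.getD e) ⁻¹' N.E)
    (hn : ∀ I ⊆ M.E \ {none}, (M.contract {none}).Indep I ↔ N.Indep ((fun o => o.getD e) '' I))
    (hs : ∀ I ⊆ M.E \ {some e},
      (M.contract {some e}).Indep I ↔ N.Indep ((fun o => o.getD e) '' I)) :
    HasMinorUsing N M none (some e) := by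
  have : Nonempty α := ⟨e⟩
  obtain ⟨y, hy, hye⟩ := exists_ne_of_one_lt_encard (lt_of_lt_of_le (by norm_num) h2) e
  have hE : ∀ o : Option α, o.getD e ∈ N.E → o ∈ M.E := fun o ho => hME ▸ ho
  have h1 : Iso (M.contract {none}) N := iso_iff_exists_bijOn.2
    ⟨_, by rw [Matroid.contract_ground, hME]; exact bijOn_getD he (Or.inl rfl), hn⟩
  have h2 : Iso (M.contract {some e}) N := iso_iff_exists_bijOn.2
    ⟨_, by rw [Matroid.contract_ground, hME]; exact bijOn_getD he (Or.inr rfl), hs⟩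
  have hye' : some y ≠ some e := by simpa using hye
  refine htrans _ M hM none (hE _ he) (some y) (hE _ hy) (some e) (hE _ he) (by simp) hye'
    (by simp) ⟨_, ⟨{some e}, ∅, by simp⟩, h2, ⟨hE _ he, by simp⟩, ⟨hE _ hy, hye'⟩⟩
    ⟨_, ⟨{none}, ∅, by simp⟩, h1, ⟨hE _ hy, by simp⟩, ⟨hE _ he, by simp⟩⟩

lemma finite_of_ground_eq_preimage_getD {N : Matroid α} [N.Finite] {e : α} (he : e ∈ N.E)
    {M : Matroid (Option α)} (hME : M.E = (fun o : Option α => o.getD e) ⁻¹' N.E) :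
    M.Finite := by
  refine ⟨?_⟩
  rw [hME]
  exact (parallelExt_finite he).ground_finite

/-- A matroid of rank zero on at least two elements does not have the transitivity property. -/
lemma Transitivity.not_rank_zero {N : Matroid α} [N.Finite] (h2 : 2 ≤ N.E.encard)
    (htrans : Transitivity N) : ¬ ∀ I, N.Indep I ↔ I = ∅ := by
  intro hN
  obtain ⟨e, he⟩ : N.E.Nonempty := by
    rw [← encard_pos]
    exact lt_of_lt_of_le (by norm_num) h2
  have : Nonempty α := ⟨e⟩
  -- `M` is a parallel pair `none`, `some e` together with loops; contracting either element of the
  -- pair leaves only loops.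
  set M := parallelExt (Matroid.uniqueBaseOn {e} N.E) e with hMdef
  have hME : M.E = (fun o : Option α => o.getD e) ⁻¹' N.E := rfl
  have hind : ∀ I, M.Indep I ↔
      (fun o : Option α => o.getD e) '' I ⊆ {e} ∧ InjOn (fun o : Option α => o.getD e) I := by
    intro I
    rw [hMdef, parallelExt, Matroid.comap_indep_iff,
      Matroid.uniqueBaseOn_indep_iff (singleton_subset_iff.2 he)]
  have hsing : ∀ x : Option α, x = none ∨ x = some e → M.Indep {x} := by
    rintro x (rfl | rfl) <;> simp [-Matroid.indep_singleton, hind]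
  have hcontract : ∀ x : Option α, x = none ∨ x = some e → ∀ I ⊆ M.E \ {x},
      ((M.contract {x}).Indep I ↔ N.Indep ((fun o => o.getD e) '' I)) := by
    intro x hx I hI
    rw [hN, image_eq_empty, (Matroid.indep_singleton.1 (hsing x hx)).contractElem_indep_iff]
    constructor
    · rintro ⟨hxI, h⟩
      rw [eq_empty_iff_forall_notMem]
      intro y hy
      obtain ⟨h1, h2⟩ := (hind _).1 h
      have hy' : y.getD e = e := h1 ⟨y, Or.inr hy, rfl⟩
      have hx' : x.getD e = e := h1 ⟨x, Or.inl rfl, rfl⟩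
      have hyx : y = x := h2 (Or.inr hy) (Or.inl rfl) (hy'.trans hx'.symm)
      exact hxI (hyx ▸ hy)
    · rintro rfl
      exact ⟨notMem_empty _, by simpa using hsing x hx⟩
  obtain ⟨N', ⟨C, D, rfl⟩, hiso, hn, hs⟩ := htrans.hasMinorUsing_none_some h2 he
    (finite_of_ground_eq_preimage_getD he hME) hME (hcontract _ (Or.inl rfl))
    (hcontract _ (Or.inr rfl))
  obtain ⟨f, -, hf⟩ := iso_iff_exists_bijOn.1 hiso
  -- A minor keeping both clones can contract only loops, so `none` remains a nonloop.
  have hloops : C ∩ M.E ⊆ M.loops := by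
    rintro y ⟨hyC, hyE⟩
    rw [← Matroid.isLoop_iff, ← Matroid.singleton_not_indep hyE, hind]
    rintro ⟨h, -⟩
    have hy : y.getD e = e := h ⟨y, rfl, rfl⟩
    rcases y with _ | y
    · exact hn.1.2 hyC
    · obtain rfl : y = e := hy
      exact hs.1.2 hyC
  have hN' : ((M.contract C).delete D).Indep {none} := by
    rw [← Matroid.contract_inter_ground_eq, Matroid.contract_eq_delete_of_subset_loops hloops,
      Matroid.delete_indep_iff, Matroid.delete_indep_iff, disjoint_singleton_left,
      disjoint_singleton_left]
    exact ⟨⟨hsing _ (Or.inl rfl), fun h => hn.1.2 h.1⟩, hn.2⟩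
  rw [hf _ (singleton_subset_iff.2 hn), hN] at hN'
  simp at hN'

lemma uniform_indep_iff {r n : ℕ} {I : Set (Fin n)} : (uniform r n).Indep I ↔ I.ncard ≤ r :=
  Iff.rfl

/-- A loopless matroid of rank one with the transitivity property has at most two elements. -/
lemma Transitivity.encard_le_two {N : Matroid α} [N.Finite] (h2 : 2 ≤ N.E.encard)
    (htrans : Transitivity N) (hN : ∀ I, N.Indep I ↔ I ⊆ N.E ∧ I.Subsingleton) :
    N.E.encard ≤ 2 := by
  classical
  by_contra! h3
  obtain ⟨e, he⟩ : N.E.Nonempty := by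
    rw [← encard_pos]
    exact lt_of_lt_of_le (by norm_num) h2
  have : Nonempty α := ⟨e⟩
  -- Pulling back along `g` turns `U_{2,3}` into a matroid where the element `2` is replaced by a
  -- parallel class and `none`, `some e` stay single.
  let g : Option α → Fin 3 := fun o => if o = none then 0 else if o = some e then 1 else 2
  have hg : ∀ x : Option α, x = none ∨ x = some e → ∀ y, g y = g x → y = x := by
    intro x hx y hxy
    simp only [g] at hxy
    grind
  have hg2 : ∀ y : Option α, y ≠ none → y ≠ some e → g y = 2 := by
    intro y hy hy'
    simp [g, hy, hy']
  set M := (uniform 2 3).comapOn ((fun o : Option α => o.getD e) ⁻¹' N.E) g with hMdef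
  have hME : M.E = (fun o : Option α => o.getD e) ⁻¹' N.E := rfl
  have hind : ∀ I ⊆ M.E, (M.Indep I ↔ (g '' I).ncard ≤ 2 ∧ InjOn g I) := by
    intro I hI
    rw [hMdef, Matroid.comapOn_indep_iff, uniform_indep_iff]
    exact ⟨fun h => ⟨h.1, h.2.1⟩, fun h => ⟨h.1, h.2, hI⟩⟩
  have hxE : ∀ x : Option α, x = none ∨ x = some e → x ∈ M.E := by
    rintro x (rfl | rfl) <;> exact he
  have hsing : ∀ x ∈ M.E, M.Indep {x} := by
    intro x hx
    rw [hind _ (singleton_subset_iff.2 hx)]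
    simp
  have hpair : ∀ x : Option α, x = none ∨ x = some e → ∀ y ∈ M.E, M.Indep {x, y} := by
    intro x hx y hy
    rw [hind _ (pair_subset (hxE x hx) hy), image_pair, injOn_pair]
    exact ⟨ncard_insert_le _ _ |>.trans (by simp), fun h => (hg x hx y h.symm).symm⟩
  have hcontract : ∀ x : Option α, x = none ∨ x = some e → ∀ I ⊆ M.E \ {x},
      ((M.contract {x}).Indep I ↔ N.Indep ((fun o => o.getD e) '' I)) := by
    intro x hx I hI
    have hb := bijOn_getD he hx
    have hxI : x ∉ I := fun h => (hI h).2 rfl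
    have hsub : (fun o : Option α => o.getD e) '' I ⊆ N.E := by
      rw [← hb.image_eq]
      exact image_mono hI
    rw [(Matroid.indep_singleton.1 (hsing x (hxE x hx))).contractElem_indep_iff, hN,
      and_iff_right hxI, and_iff_right hsub, subsingleton_image_iff_of_injOn (hb.injOn.mono hI)]
    constructor
    · intro h
      have hfin : I.Finite :=
        (finite_of_ground_eq_preimage_getD he hME).ground_finite.subset (hI.trans sdiff_subset)
      obtain ⟨h1, h2⟩ := (hind _ h.subset_ground).1 h
      rw [h2.ncard_image, ncard_insert_of_notMem hxI hfin] at h1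
      have := hfin.to_subtype
      exact ncard_le_one_iff_subsingleton.1 (by omega)
    · intro h
      obtain rfl | ⟨y, rfl⟩ := h.eq_empty_or_singleton
      · simpa using hsing x (hxE x hx)
      · exact hpair x hx y (hI rfl).1
  obtain ⟨N', ⟨C, D, rfl⟩, hiso, hn, hs⟩ := htrans.hasMinorUsing_none_some h2 he
    (finite_of_ground_eq_preimage_getD he hME) hME (hcontract _ (Or.inl rfl))
    (hcontract _ (Or.inr rfl))
  obtain ⟨f, hfb, hf⟩ := iso_iff_exists_bijOn.1 hiso
  by_cases hC : ∃ y, y ∈ C ∧ y ∈ M.E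
  · obtain ⟨y, hyC, hyE⟩ := hC
    -- With at least three elements, the minor keeps some `z` of the parallel class; contracting `y`
    -- from that class makes `z` a loop.
    obtain ⟨z, hz, hz'⟩ : ∃ z ∈ ((M.contract C).delete D).E, z ∉ ({none, some e} : Set _) := by
      by_contra! h
      have hcard : ((M.contract C).delete D).E.encard = N.E.encard := hiso.encard_eq
      exact h3.not_ge (hcard ▸ (encard_le_encard h).trans (encard_pair (by simp)).le)
    have hgz : g z = 2 := hg2 z (fun h => hz' (Or.inl h)) (fun h => hz' (Or.inr h))
    have hgy : g y = 2 := hg2 y (fun h => hn.1.2 (h ▸ hyC)) (fun h => hs.1.2 (h ▸ hyC))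
    have hzy : z ≠ y := fun h => hz.1.2 (h ▸ hyC)
    have hzind : ((M.contract C).delete D).Indep {z} := by
      rw [hf _ (singleton_subset_iff.2 hz), hN, image_singleton]
      exact ⟨singleton_subset_iff.2 (hfb.mapsTo hz), subsingleton_singleton⟩
    have hznl := (Matroid.contract_isNonloop_iff.1 (Matroid.indep_singleton.1 hzind.of_delete)).2
    apply hznl
    have hzE : z ∈ M.E := hz.1.1
    have hcl : z ∈ M.closure {y} := by
      rw [(hsing y hyE).mem_closure_iff]
      left
      refine ⟨fun h => hzy ?_, pair_subset hzE hyE⟩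
      exact ((hind _ (pair_subset hzE hyE)).1 h).2 (by simp) (by simp) (hgz.trans hgy.symm)
    exact M.closure_subset_closure (singleton_subset_iff.2 hyC) hcl
  · have hdis : Disjoint C M.E := disjoint_left.2 fun y hy hy' => hC ⟨y, hy, hy'⟩
    rw [Matroid.contract_eq_self_iff.2 hdis] at hn hs hf hfb
    -- With nothing contracted, `{none, some e}` stays independent, so the minor has rank above one.
    have hp : (M.delete D).Indep {none, some e} := by
      rw [Matroid.delete_indep_iff]
      refine ⟨hpair _ (Or.inl rfl) _ hs.1, disjoint_left.2 ?_⟩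
      rintro _ (rfl | rfl)
      · exact hn.2
      · exact hs.2
    rw [hf _ (pair_subset hn hs), hN] at hp
    have h := hfb.injOn hn hs (hp.2 ⟨none, by simp, rfl⟩ ⟨some e, by simp, rfl⟩)
    simp at h

lemma iso_uniform_one_two {N : Matroid α} (h2 : N.E.encard = 2)
    (hN : ∀ I, N.Indep I ↔ I ⊆ N.E ∧ I.Subsingleton) : Iso N (uniform 1 2) := by
  classical
  obtain ⟨a, b, hab, hE⟩ := encard_eq_two.1 h2
  have hb : BijOn (fun x => if x = a then (0 : Fin 2) else 1) N.E (uniform 1 2).E := by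
    rw [hE]
    refine ⟨fun _ _ => mem_univ _, ?_, fun y _ => ?_⟩
    · rw [injOn_pair]
      simp [hab.symm]
    · fin_cases y
      · exact ⟨a, by simp⟩
      · exact ⟨b, by simp [hab.symm]⟩
  refine iso_iff_exists_bijOn.2 ⟨_, hb, fun I hI => ?_⟩
  rw [hN, and_iff_right hI, uniform_indep_iff, ncard_le_one_iff_subsingleton,
    subsingleton_image_iff_of_injOn (hb.injOn.mono hI)]

end NConn

theorem corollary1p3 {α : Type*} (N : Matroid α) [N.Finite] (hN : 2 ≤ N.E.encard)
    (htrans : NConn.Transitivity N) (hconn : NConn.DeleteOrContract N) :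
    NConn.Iso N (NConn.uniform 1 2) := by
  rcases htrans.indep_iff_subsingleton hN hconn with h | h
  · exact absurd h (htrans.not_rank_zero hN)
  · exact NConn.iso_uniform_one_two ((htrans.encard_le_two hN h).antisymm hN) h
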